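/- For real numbers $s\ge 0$, $\theta$, $t$ put $$ A_{(s,\theta,t)}=\begin{pmatrix} 1 & -\sqrt2\,s e^{-i\theta} & -s^2+it\\ 0&1&\sqrt2\,s e^{i\theta}\\ 0&0&1\end{pmatrix},\qquad B_{(s,\theta,t)}=\begin{pmatrix} 1&0&0\\ \sqrt2\,s e^{i\theta}&1&0\\ -s^2+it&-\sqrt2\,s e^{-i\theta}&1\end{pmatrix}. $$ These are elements of $\mathrm{SU}(2,1)$, the group of complex $3\times 3$ matrices of determinant $1$ preserving the Hermitian form $\langle z,w\rangle=z_1\bar w_3+z_2\bar w_2+z_3\bar w_1$; they are the Heisenberg translations fixing $\infty=[1:0:0]$ and $o=[0:0:1]$, respectively, associated with the element $(se^{i\theta},t)$ of the Heisenberg group $\mathbb C\times\mathbb R$. **Theorem 1.2.** Let $(s_1e^{i\theta_1},t_1)$ and $(s_2e^{i\theta_2},t_2)$, with $s_1,s_2\ge 0$ and $\theta_1,\theta_2,t_1,t_2\in\mathbb R$, be both different from $(0,0)$, and let $A=A_{(s_1,\theta_1,t_1)}$ and $B=B_{(s_2,\theta_2,t_2)}$. (The angle $\theta_j$ plays no role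 if $s_j=0$.) If $s_1$ and $s_2$ are both non-zero, suppose that $-\pi/2\le\theta_1-\theta_2\le\pi/2$ (which can be achieved by replacing $A$ or $B$ by its inverse, and changing the angles by multiples of $2\pi$). If at least one of the following four conditions holds, then the group $\langle A,B\rangle$ is discrete in $\mathrm{SU}(2,1)$ and is freely generated by $A$ and $B$. 1. $$|s_1^2+it_1|^{1/2}|s_2^2+it_2|^{1/2}\ \ge\ 2^{1/2}\left(\Bigl(1-\tfrac{t_2}{|s_2^2+it_2|}\Bigr)^{1/3}+\Bigl(1+\tfrac{t_2}{|s_2^2+it_2|}\Bigr)^{1/3}\right)^{3/4}\left(\Bigl(1-\tfrac{t_1}{|s_1^2+it_1|}\Bigr)^{1/3}+\Bigl(1+\tfrac{t_1}{|s_1^2+it_1|}\Bigr)^{1/3}\right)^{3/4}.$$ 2. $s_1\ne0$, and $$s_1\,|s_2^2+it_2|^{1/2}\ \ge\ \begin{cases}\dfrac{2s_2^3}{|s_2^2+it_2|^{3/2}}\cos(\theta_1-\theta_2)+2 & \text{if } s_2\neq0,\\[2mm] 2&\text{if } s_2=0.\end{cases}$$ 3. $s_2\ne0$, and $$|s_1^2+it_1|^{1/2}\,s_2\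 \ge\ \begin{cases}\dfrac{2s_1^3}{|s_1^2+it_1|^{3/2}}\cos(\theta_1-\theta_2)+2 & \text{if } s_1\neq0,\\[2mm] 2&\text{if } s_1=0.\end{cases}$$ 4. $s_1\ne0$, $s_2\neq0$, and $s_1s_2\ge 4\cos^3\bigl((\theta_1-\theta_2)/3\bigr)$. -/

import Mathlib

open Matrix

/-- The matrix `H` of the Hermitian form `⟨z, w⟩ = w* H z` of signature `(2,1)` on `ℂ³`. -/
def hermH : Matrix (Fin 3) (Fin 3) ℂ :=
  !![0, 0, 1; 0, 1, 0; 1, 0, 0]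

/-- The group `SU(2,1)` of complex `3 × 3` matrices of determinant `1` which preserve the
Hermitian form given by `hermH`. It carries the topology of entrywise convergence, inherited
from `SL(3, ℂ)`. -/
def SU21 : Subgroup (Matrix.SpecialLinearGroup (Fin 3) ℂ) where
  carrier := {g | (g : Matrix (Fin 3) (Fin 3) ℂ)ᴴ * hermH * (g : Matrix (Fin 3) (Fin 3) ℂ) = hermH}
  one_mem' := by simp
  mul_mem' := by
    intro a b ha hb
    simp only [Set.mem_ofPred_eq, Matrix.SpecialLinearGroup.coe_mul,
      Matrix.conjTranspose_mul] at *
    calc _ = (b : Matrix (Fin 3) (Fin 3) ℂ)ᴴ *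
          ((a : Matrix (Fin 3) (Fin 3) ℂ)ᴴ * hermH * (a : Matrix (Fin 3) (Fin 3) ℂ)) *
          (b : Matrix (Fin 3) (Fin 3) ℂ) := by simp only [Matrix.mul_assoc]
      _ = hermH := by rw [ha, hb]
  inv_mem' := by
    intro a ha
    simp only [Set.mem_ofPred_eq] at *
    have h1 : (a : Matrix (Fin 3) (Fin 3) ℂ) * ((a⁻¹ : Matrix.SpecialLinearGroup (Fin 3) ℂ) :
        Matrix (Fin 3) (Fin 3) ℂ) = 1 := by
      rw [← Matrix.SpecialLinearGroup.coe_mul, mul_inv_cancel, Matrix.SpecialLinearGroup.coe_one]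
    generalize ((a⁻¹ : Matrix.SpecialLinearGroup (Fin 3) ℂ) : Matrix (Fin 3) (Fin 3) ℂ) = c at *
    have h2 : cᴴ * (a : Matrix (Fin 3) (Fin 3) ℂ)ᴴ = 1 := by
      rw [← Matrix.conjTranspose_mul, h1, Matrix.conjTranspose_one]
    calc cᴴ * hermH * c
        = cᴴ * ((a : Matrix (Fin 3) (Fin 3) ℂ)ᴴ * hermH * (a : Matrix (Fin 3) (Fin 3) ℂ)) * c := by
          rw [ha]
      _ = (cᴴ * (a : Matrix (Fin 3) (Fin 3) ℂ)ᴴ) * hermH *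
          ((a : Matrix (Fin 3) (Fin 3) ℂ) * c) := by simp only [Matrix.mul_assoc]
      _ = hermH := by rw [h1, h2, Matrix.one_mul, Matrix.mul_one]

/-- The matrix of the Heisenberg translation fixing `∞` (the class of `(1,0,0)`), associated with
the element `(s e^{iθ}, t)` of the Heisenberg group. -/
noncomputable def matA (s θ t : ℝ) : Matrix (Fin 3) (Fin 3) ℂ :=
  !![1, -(√2 * s * Complex.exp (-(Complex.I * θ))), -(s : ℂ) ^ 2 + Complex.I * t;
     0, 1, √2 * s * Complex.exp (Complex.I * θ);
     0, 0, 1]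

/-- The matrix of the Heisenberg translation fixing `o` (the class of `(0,0,1)`), associated with
the element `(s e^{iθ}, t)` of the Heisenberg group. -/
noncomputable def matB (s θ t : ℝ) : Matrix (Fin 3) (Fin 3) ℂ :=
  !![1, 0, 0;
     √2 * s * Complex.exp (Complex.I * θ), 1, 0;
     -(s : ℂ) ^ 2 + Complex.I * t, -(√2 * s * Complex.exp (-(Complex.I * θ))), 1]

theorem det_matA (s θ t : ℝ) : (matA s θ t).det = 1 := by
  simp [matA, Matrix.det_fin_three]

theorem det_matB (s θ t : ℝ) : (matB s θ t).det = 1 := by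
  simp [matB, Matrix.det_fin_three]

theorem sqrt_two_mul_exp_aux (s θ : ℝ) :
    ((√2 : ℝ) * s * Complex.exp (-(Complex.I * θ))) * ((√2 : ℝ) * s * Complex.exp (Complex.I * θ))
      = 2 * (s : ℂ) ^ 2 := by
  have h : Complex.exp (-(Complex.I * θ)) * Complex.exp (Complex.I * θ) = 1 := by
    rw [← Complex.exp_add]; simp
  have h2 : ((√2 : ℝ) : ℂ) * ((√2 : ℝ) : ℂ) = 2 := by
    rw [← Complex.ofReal_mul]; simp
  linear_combination (((√2 : ℝ) : ℂ) * ((√2 : ℝ) : ℂ) * (s : ℂ) ^ 2) * h + (s : ℂ) ^ 2 * h2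

theorem star_exp_aux (θ : ℝ) :
    (starRingEnd ℂ) (Complex.exp (Complex.I * θ)) = Complex.exp (-(Complex.I * θ)) := by
  rw [← Complex.exp_conj]; simp

theorem star_exp_neg_aux (θ : ℝ) :
    (starRingEnd ℂ) (Complex.exp (-(Complex.I * θ))) = Complex.exp (Complex.I * θ) := by
  rw [← Complex.exp_conj]; simp

theorem matA_unitary (s θ t : ℝ) : (matA s θ t)ᴴ * hermH * matA s θ t = hermH := by
  have h := sqrt_two_mul_exp_aux s θ
  ext i j
  fin_cases i <;> fin_cases j <;>
    simp [matA, hermH, Matrix.mul_apply, Fin.sum_univ_three, star_exp_aux, star_exp_neg_aux]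
  linear_combination h

theorem matB_unitary (s θ t : ℝ) : (matB s θ t)ᴴ * hermH * matB s θ t = hermH := by
  have h := sqrt_two_mul_exp_aux s θ
  ext i j
  fin_cases i <;> fin_cases j <;>
    simp [matB, hermH, Matrix.mul_apply, Fin.sum_univ_three, star_exp_aux, star_exp_neg_aux]
  linear_combination h

/-- The Heisenberg translation fixing `∞` with parameters `(s e^{iθ}, t)`, in `SU(2,1)`. -/
noncomputable def heisA (s θ t : ℝ) : SU21 :=
  ⟨⟨matA s θ t, det_matA s θ t⟩, matA_unitary s θ t⟩

/-- The Heisenberg translation fixing `o` with parameters `(s e^{iθ}, t)`, in `SU(2,1)`. -/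
noncomputable def heisB (s θ t : ℝ) : SU21 :=
  ⟨⟨matB s θ t, det_matB s θ t⟩, matB_unitary s θ t⟩

/-- The modulus `|s² + i t|`. -/
noncomputable def heisMod (s t : ℝ) : ℝ :=
  ‖(s : ℂ) ^ 2 + Complex.I * t‖

/-!
The group `SU21` acts on the negative vectors of `ℂ³`, the homogeneous coordinates of the complex
hyperbolic plane, and the theorem is an instance of Klein's combination theorem for this action
(`discrete_and_free_of_domains`): it suffices to find open sets `P` and `Q` which cover the negative
vectors and have a common negative vector, such that `P` is disjoint from its translates by the
nontrivial powers of `A`, and `Q` from its translates by those of `B`. Then every nontrivial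
reduced word moves a point of `P ∩ Q` out of `P ∩ Q`, which gives freeness and, as `P ∩ Q` is open,
discreteness. Working with negative vectors instead of boundary points makes all estimates strict,
so the equality cases of the four conditions need no separate treatment.

Two kinds of domains are used for a Heisenberg translation: a `slab` bounded by two fans, and the
`fordDomain` outside the isometric spheres of the translation and of its inverse. The disjointness
of the translates of the former is evident; for the latter it follows from the convexity of the
squared modulus of the relevant coordinate along a one-parameter group
(`norm_lt_norm_heisCoord_zpow`). Reversing the order of the coordinates exchanges the translations
fixing `∞` and `o`, so all this is stated for the latter only. The conditions say that the
domains cover: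

* for two Ford domains, the insides of the isometric spheres of the two translations are separated
  by a sphere of points with `|v 2| = ρ * |v 0|` (`normSq_lt_of_notMem_fordDomain`), where the best
  `ρ` comes from the minimum of a quartic polynomial, found by Cardano's formula
  (`quartic_lower_bound`);
* for a slab and a Ford domain, the two isometric spheres project into discs in `ℂ`, and the slab,
  centred between the discs, is wide enough to contain both
  (`exists_rev_mem_slab_of_notMem_fordDomain`);
* for two slabs, the product of the two defining functions is bounded by the maximum of the
  trigonometric function in `abs_cos_mul_one_add_abs_cos_le` (`rev_mem_slab_of_notMem_slab`).
-/

/-! ### The combination theorem -/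

/-- Ping-pong along a reduced word in the letters `f i`, starting at a point `p` of `⋂ i, D i`: the
image of `p` under the word is obtained by a nonzero power of the letter in front from a point of
the corresponding set `D i`. -/
theorem exists_zpow_smul_of_isReduced {G X : Type*} [Group G] [MulAction G X]
    (f : Fin 2 → G) {Ω : Set X} (D : Fin 2 → Set X)
    (hΩ : ∀ (g : G), ∀ x ∈ Ω, g • x ∈ Ω) (hcov : ∀ x ∈ Ω, ∀ i j, i ≠ j → x ∉ D i → x ∈ D j)
    (hdisj : ∀ i, ∀ n : ℤ, n ≠ 0 → ∀ x ∈ Ω, x ∈ D i → f i ^ n • x ∉ D i)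
    {p : X} (hpΩ : p ∈ Ω) (hp : ∀ i, p ∈ D i) (L : List (Fin 2 × Bool)) :
    ∀ i ε, FreeGroup.IsReduced ((i, ε) :: L) → ∃ k : ℤ, 0 < (bif ε then k else -k) ∧
      ∃ y ∈ Ω, y ∈ D i ∧ FreeGroup.lift f (FreeGroup.mk ((i, ε) :: L)) • p = f i ^ k • y := by
  induction L with
  | nil =>
    intro i ε _
    refine ⟨bif ε then 1 else -1, by cases ε <;> simp, p, hpΩ, hp i, ?_⟩
    cases ε <;> simp [FreeGroup.lift_mk]
  | cons c L ih =>
    obtain ⟨j, δ⟩ := c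
    intro i ε h
    rw [FreeGroup.isReduced_cons_cons] at h
    obtain ⟨k, hk, y, hyΩ, hy, e⟩ := ih j δ h.2
    have e1 : FreeGroup.lift f (FreeGroup.mk ((i, ε) :: (j, δ) :: L)) • p =
        f i ^ (bif ε then 1 else -1 : ℤ) • (f j ^ k • y) := by
      rw [← e, smul_smul]
      cases ε <;> simp [FreeGroup.lift_mk]
    by_cases hij : i = j
    · subst hij
      have hεδ : ε = δ := h.1 rfl
      subst hεδ
      refine ⟨(bif ε then 1 else -1 : ℤ) + k, ?_, y, hyΩ, hy, ?_⟩
      · cases ε <;> simp only [cond_true, cond_false] at hk ⊢ <;> omega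
      · rw [e1, smul_smul, _root_.zpow_add]
    · refine ⟨bif ε then 1 else -1, by cases ε <;> simp, f j ^ k • y, hΩ _ _ hyΩ, ?_, e1⟩
      refine hcov _ (hΩ _ _ hyΩ) j i (Ne.symm hij) (hdisj j k ?_ y hyΩ hy)
      rintro rfl
      cases δ <;> simp at hk

/-- The Klein combination theorem, in a form that keeps track of the orbit of a point `p` in the
intersection of the two fundamental domains. -/
theorem lift_smul_notMem_of_ne_one {G X : Type*} [Group G] [MulAction G X]
    (f : Fin 2 → G) {Ω : Set X} (D : Fin 2 → Set X)
    (hΩ : ∀ (g : G), ∀ x ∈ Ω, g • x ∈ Ω) (hcov : ∀ x ∈ Ω, ∀ i j, i ≠ j → x ∉ D i → x ∈ D j)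
    (hdisj : ∀ i, ∀ n : ℤ, n ≠ 0 → ∀ x ∈ Ω, x ∈ D i → f i ^ n • x ∉ D i)
    {p : X} (hpΩ : p ∈ Ω) (hp : ∀ i, p ∈ D i) {w : FreeGroup (Fin 2)} (hw : w ≠ 1) :
    ∃ i, FreeGroup.lift f w • p ∉ D i := by
  rcases hL : w.toWord with _ | ⟨⟨i, ε⟩, L⟩
  · exact absurd (FreeGroup.toWord_eq_nil_iff.1 hL) hw
  · have hred : FreeGroup.IsReduced ((i, ε) :: L) := hL ▸ FreeGroup.isReduced_toWord
    obtain ⟨k, hk, y, hyΩ, hy, e⟩ :=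
      exists_zpow_smul_of_isReduced f D hΩ hcov hdisj hpΩ hp L i ε hred
    refine ⟨i, ?_⟩
    rw [← FreeGroup.mk_toWord (x := w), hL, e]
    refine hdisj i k ?_ y hyΩ hy
    rintro rfl
    cases ε <;> simp at hk

/-! ### The action on negative vectors -/

theorem SU21.smul_eq_mulVec (g : SU21) (v : Fin 3 → ℂ) :
    g • v = (g : SpecialLinearGroup (Fin 3) ℂ).1 *ᵥ v := rfl

/-- The vectors of `ℂ³` on which the Hermitian form is negative; their lines are the points of the
complex hyperbolic plane. -/
def negVec : Set (Fin 3 → ℂ) :=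
  {v | 2 * (v 2 * starRingEnd ℂ (v 0)).re + Complex.normSq (v 1) < 0}

theorem mem_negVec_iff (v : Fin 3 → ℂ) : v ∈ negVec ↔ (star v ⬝ᵥ hermH *ᵥ v).re < 0 := by
  have : (star v ⬝ᵥ hermH *ᵥ v).re =
      2 * (v 2 * starRingEnd ℂ (v 0)).re + Complex.normSq (v 1) := by
    simp [dotProduct, mulVec, hermH, Fin.sum_univ_three, Complex.normSq_apply]
    ring
  rw [this]; rfl

theorem smul_mem_negVec (g : SU21) (v : Fin 3 → ℂ) (hv : v ∈ negVec) : g • v ∈ negVec := by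
  rw [mem_negVec_iff] at hv ⊢
  have hg : (g : SpecialLinearGroup (Fin 3) ℂ).1ᴴ * hermH *
    (g : SpecialLinearGroup (Fin 3) ℂ).1 = hermH := g.2
  rwa [SU21.smul_eq_mulVec, star_mulVec, ← dotProduct_mulVec, mulVec_mulVec, mulVec_mulVec,
    hg]

theorem rev_mem_negVec {v : Fin 3 → ℂ} (hv : v ∈ negVec) : v ∘ Fin.rev ∈ negVec := by
  simp only [negVec, Set.mem_ofPred_eq, Function.comp] at hv ⊢
  simp only [show Fin.rev (0 : Fin 3) = 2 from rfl, show Fin.rev (1 : Fin 3) = 1 from rfl,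
    show Fin.rev (2 : Fin 3) = 0 from rfl, Complex.mul_re, Complex.conj_re, Complex.conj_im]
    at hv ⊢
  linarith

/-- Two open sets which cover the negative vectors, of which the first is disjoint on negative
vectors from its translates by the nontrivial powers of `a`, and the second from its translates by
those of `b`, and which share a negative vector, show that `a` and `b` freely generate a
discrete group. -/
theorem discrete_and_free_of_domains (a b : SU21) {P Q : Set (Fin 3 → ℂ)} (hP : IsOpen P)
    (hQ : IsOpen Q) (hcov : ∀ v ∈ negVec, v ∉ P → v ∈ Q)
    (ha : ∀ n : ℤ, n ≠ 0 → ∀ v ∈ negVec, v ∈ P → a ^ n • v ∉ P)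
    (hb : ∀ n : ℤ, n ≠ 0 → ∀ v ∈ negVec, v ∈ Q → b ^ n • v ∉ Q)
    {p : Fin 3 → ℂ} (hp : p ∈ negVec) (hpP : p ∈ P) (hpQ : p ∈ Q) :
    DiscreteTopology (Subgroup.closure ({a, b} : Set SU21)) ∧
      Function.Injective (FreeGroup.lift ![a, b]) := by
  have key : ∀ w : FreeGroup (Fin 2), w ≠ 1 →
      ¬ (FreeGroup.lift ![a, b] w • p ∈ P ∧ FreeGroup.lift ![a, b] w • p ∈ Q) := by
    intro w hw h
    obtain ⟨i, hi⟩ := lift_smul_notMem_of_ne_one ![a, b] (Ω := negVec) ![P, Q] smul_mem_negVec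
      (by
        intro x hx i j hij
        fin_cases i <;> fin_cases j
        · exact absurd rfl hij
        · exact hcov x hx
        · intro h
          by_contra h'
          exact h (hcov x hx h')
        · exact absurd rfl hij)
      (by
        intro i
        fin_cases i
        · exact ha
        · exact hb) hp
      (by
        intro i
        fin_cases i
        · exact hpP
        · exact hpQ) hw
    fin_cases i
    · exact hi h.1
    · exact hi h.2
  constructor
  · apply discreteTopology_of_isOpen_singleton_one
    have hval : Continuous fun g : SU21 => (g : SpecialLinearGroup (Fin 3) ℂ).1 :=
      continuous_subtype_val.comp continuous_subtype_val
    have hcont : Continuous fun g : Subgroup.closure ({a, b} : Set SU21) => (g : SU21) • p := by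
      simp only [SU21.smul_eq_mulVec]
      exact (hval.comp continuous_subtype_val).matrix_mulVec continuous_const
    convert (hP.inter hQ).preimage hcont using 1
    ext g
    simp only [Set.mem_singleton_iff, Set.mem_preimage, Set.mem_inter_iff]
    constructor
    · rintro rfl
      simpa using ⟨hpP, hpQ⟩
    · intro h
      have hg : (g : SU21) ∈ (FreeGroup.lift ![a, b]).range := by
        rw [FreeGroup.range_lift_eq_closure]
        convert g.2
        ext x; simp [eq_comm, or_comm]
      obtain ⟨w, hw⟩ := hg
      by_cases h1 : w = 1
      · subst h1
        exact Subtype.ext (by rw [← hw, map_one]; rfl)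
      · exact absurd (by rw [hw]; exact h) (key w h1)
  · rw [injective_iff_map_eq_one]
    intro w hw
    by_contra h1
    exact key w h1 (by rw [hw, one_smul]; exact ⟨hpP, hpQ⟩)

/-! ### Heisenberg translations -/

/-- The last coordinate of `heisB s θ t • v`. -/
noncomputable def heisCoord (s θ t : ℝ) (v : Fin 3 → ℂ) : ℂ :=
  v 2 - √2 * s * Complex.exp (-(Complex.I * θ)) * v 1 + (-(s : ℂ) ^ 2 + Complex.I * t) * v 0

theorem heisB_smul (s θ t : ℝ) (v : Fin 3 → ℂ) :
    heisB s θ t • v =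
      ![v 0, v 1 + √2 * s * Complex.exp (Complex.I * θ) * v 0, heisCoord s θ t v] := by
  rw [SU21.smul_eq_mulVec]
  ext i
  fin_cases i <;> simp [heisB, matB, mulVec, dotProduct, Fin.sum_univ_three, heisCoord] <;> ring

/-- Reversing the coordinates exchanges the translations fixing `∞` with those fixing `o`. -/
theorem heisA_smul (s θ t : ℝ) (v : Fin 3 → ℂ) :
    heisA s θ t • v = (heisB s θ t • (v ∘ Fin.rev)) ∘ Fin.rev := by
  rw [heisB_smul, SU21.smul_eq_mulVec]
  ext i
  fin_cases i <;>
    simp [heisA, matA, mulVec, dotProduct, Fin.sum_univ_three, heisCoord, Function.comp,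
      show Fin.rev (0 : Fin 3) = 2 from rfl, show Fin.rev (1 : Fin 3) = 1 from rfl,
      show Fin.rev (2 : Fin 3) = 0 from rfl]
  ring

theorem heisB_mul (s s' θ t t' : ℝ) :
    heisB s θ t * heisB s' θ t' = heisB (s + s') θ (t + t') := by
  have h : ((√2 : ℝ) : ℂ) * ((√2 : ℝ) : ℂ) = 2 := by
    rw [← Complex.ofReal_mul]; simp
  have h' : Complex.exp (-(Complex.I * θ)) * Complex.exp (Complex.I * θ) = 1 := by
    rw [← Complex.exp_add]; simp
  apply Subtype.ext
  apply Subtype.ext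
  change matB s θ t * matB s' θ t' = matB (s + s') θ (t + t')
  ext i j
  fin_cases i <;> fin_cases j <;>
    simp [matB, Matrix.mul_apply, Fin.sum_univ_three]
  · ring
  · linear_combination (-(s : ℂ) * s' * √2 * √2) * h' - (s : ℂ) * s' * h
  · ring

theorem heisB_zero (θ : ℝ) : heisB 0 θ 0 = 1 := by
  apply Subtype.ext
  apply Subtype.ext
  change matB 0 θ 0 = 1
  ext i j
  fin_cases i <;> fin_cases j <;> simp [matB]

theorem heisB_inv (s θ t : ℝ) : (heisB s θ t)⁻¹ = heisB (-s) θ (-t) := by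
  rw [inv_eq_iff_mul_eq_one, heisB_mul, add_neg_cancel, add_neg_cancel, heisB_zero]

theorem heisB_pow (s θ t : ℝ) (n : ℕ) : heisB s θ t ^ n = heisB (n * s) θ (n * t) := by
  induction n with
  | zero => simp [heisB_zero]
  | succ n ih =>
    rw [pow_succ, ih, heisB_mul]
    congr 1 <;> push_cast <;> ring

theorem heisB_zpow (s θ t : ℝ) (n : ℤ) : heisB s θ t ^ n = heisB (n * s) θ (n * t) := by
  cases n with
  | ofNat n => simpa using heisB_pow s θ t n
  | negSucc n =>
    rw [zpow_negSucc, heisB_pow, heisB_inv]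
    congr 1 <;> push_cast <;> ring

theorem heisA_zpow_smul (s θ t : ℝ) (n : ℤ) (v : Fin 3 → ℂ) :
    heisA s θ t ^ n • v = (heisB s θ t ^ n • (v ∘ Fin.rev)) ∘ Fin.rev := by
  have hrev : ∀ u : Fin 3 → ℂ, (u ∘ Fin.rev) ∘ Fin.rev = u := fun u => by
    ext i; simp
  have hpow : ∀ (n : ℕ) (v : Fin 3 → ℂ),
      heisA s θ t ^ n • v = (heisB s θ t ^ n • (v ∘ Fin.rev)) ∘ Fin.rev := by
    intro n
    induction n with
    | zero => intro v; simp [hrev]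
    | succ n ih =>
      intro v
      rw [pow_succ, mul_smul, ih, heisA_smul, hrev, pow_succ, mul_smul]
  cases n with
  | ofNat n => simpa using hpow n v
  | negSucc n =>
    rw [zpow_negSucc, zpow_negSucc, inv_smul_eq_iff, hpow, hrev, smul_inv_smul, hrev]

theorem heisMod_sq (s t : ℝ) : heisMod s t ^ 2 = s ^ 4 + t ^ 2 := by
  rw [heisMod, ← Complex.normSq_eq_norm_sq, Complex.normSq_apply]
  simp [pow_two]
  ring

/-! ### Slabs and Ford domains -/

/-- The Ford-type domain of `heisB s θ t`: the points which lie outside the isometric spheres of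
`heisB s θ t` and of its inverse. -/
def fordDomain (s θ t : ℝ) : Set (Fin 3 → ℂ) :=
  {v | ‖v 2‖ < ‖heisCoord s θ t v‖ ∧ ‖v 2‖ < ‖heisCoord (-s) θ (-t) v‖}

/-- The slab between two fans of `heisB s θ t`: the points `v` such that the real part of
`exp (-iθ) * v 1 / v 0` is at a distance less than `w` from `c`. -/
def slab (θ w c : ℝ) : Set (Fin 3 → ℂ) :=
  {v | |(Complex.exp (-(Complex.I * θ)) * v 1 * starRingEnd ℂ (v 0)).re -
    c * Complex.normSq (v 0)| < w * Complex.normSq (v 0)}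

theorem isOpen_fordDomain (s θ t : ℝ) : IsOpen (fordDomain s θ t) := by
  have h : ∀ s t, Continuous (heisCoord s θ t) := fun s t => by
    unfold heisCoord; fun_prop
  exact (isOpen_lt (by fun_prop) (h s t).norm).inter (isOpen_lt (by fun_prop) (h _ _).norm)

theorem isOpen_slab (θ w c : ℝ) : IsOpen (slab θ w c) := by
  have h : Continuous fun v : Fin 3 → ℂ => Complex.normSq (v 0) :=
    Complex.continuous_normSq.comp (continuous_apply 0)
  exact isOpen_lt ((Complex.continuous_re.comp (by fun_prop)).sub
    (continuous_const.mul h)).abs (continuous_const.mul h)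

theorem coord_zero_ne_zero_of_mem_negVec {v : Fin 3 → ℂ} (hv : v ∈ negVec) : v 0 ≠ 0 := by
  intro h
  simp only [negVec, Set.mem_ofPred_eq, h, map_zero, mul_zero, Complex.zero_re, zero_add] at hv
  exact absurd (Complex.normSq_nonneg (v 1)) (not_le.2 hv)

/-- A negative vector may be rescaled to have first coordinate `1`. -/
theorem exists_normalization {v : Fin 3 → ℂ} (hv : v ∈ negVec) :
    ∃ c Z W : ℂ, c ≠ 0 ∧ v = ![c, c * Z, c * W] ∧ 2 * W.re + Complex.normSq Z < 0 := by
  have h0 := coord_zero_ne_zero_of_mem_negVec hv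
  have e1 : v 1 = v 0 * (v 1 / v 0) := by field_simp
  have e2 : v 2 = v 0 * (v 2 / v 0) := by field_simp
  refine ⟨v 0, v 1 / v 0, v 2 / v 0, h0, ?_, ?_⟩
  · ext i
    fin_cases i
    · rfl
    · exact e1
    · exact e2
  · have hpos : 0 < Complex.normSq (v 0) := Complex.normSq_pos.2 h0
    simp only [negVec, Set.mem_ofPred_eq] at hv
    generalize v 1 / v 0 = Z at *
    generalize v 2 / v 0 = W at *
    rw [e1, e2, map_mul] at hv
    have : (v 0 * W * starRingEnd ℂ (v 0)).re = Complex.normSq (v 0) * W.re := by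
      simp [Complex.normSq_apply]; ring
    rw [this] at hv
    by_contra hcon
    nlinarith [mul_nonneg hpos.le (not_lt.1 hcon)]

theorem heisCoord_smul (s θ t : ℝ) (c Z W : ℂ) :
    heisCoord s θ t ![c, c * Z, c * W] = c * heisCoord s θ t ![1, Z, W] := by
  simp [heisCoord]; ring

/-- A form of convexity of `x ↦ (α + β * x + γ * x ^ 2) ^ 2 + (u + δ * x) ^ 2`, where the quadratic
polynomial in the first square is nonnegative: an increase from `0` to `1` persists beyond `1`.
The function is the squared modulus of the last coordinate along the orbit of a negative vector
under a one-parameter group of Heisenberg translations. -/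
theorem sq_add_sq_lt_of_convex {α β γ u δ x : ℝ} (hdisc : β ^ 2 ≤ 4 * α * γ)
    (hx : 1 ≤ x) (h : α ^ 2 + u ^ 2 < (α + β + γ) ^ 2 + (u + δ) ^ 2) :
    α ^ 2 + u ^ 2 < (α + β * x + γ * x ^ 2) ^ 2 + (u + δ * x) ^ 2 := by
  have key : 0 ≤ β ^ 2 + 2 * α * γ + 2 * β * γ * (x + 1) + γ ^ 2 * (x ^ 2 + x + 1) + δ ^ 2 := by
    nlinarith [sq_nonneg (3 * β + 2 * γ * (x + 1)), sq_nonneg (γ * (x - 1)),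
      sq_nonneg (γ * x), sq_nonneg γ, sq_nonneg δ]
  have h2 : 0 ≤ x * (x - 1) * (β ^ 2 + 2 * α * γ + 2 * β * γ * (x + 1) +
      γ ^ 2 * (x ^ 2 + x + 1) + δ ^ 2) :=
    mul_nonneg (mul_nonneg (by linarith) (by linarith)) key
  nlinarith [mul_pos (show 0 < x by linarith) (sub_pos.2 h)]

theorem normSq_heisCoord (s θ t : ℝ) (Z W : ℂ) :
    Complex.normSq (heisCoord s θ t ![1, Z, W]) =
      (-W.re + √2 * (Complex.exp (-(Complex.I * θ)) * Z).re * s + s ^ 2) ^ 2 +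
      (W.im - √2 * (Complex.exp (-(Complex.I * θ)) * Z).im * s + t) ^ 2 := by
  have e : heisCoord s θ t ![1, Z, W] =
      W - (√2 * s : ℝ) * (Complex.exp (-(Complex.I * θ)) * Z) + ((-s ^ 2 : ℝ) + Complex.I * t) := by
    simp [heisCoord]; ring
  rw [e]
  generalize Complex.exp (-(Complex.I * θ)) * Z = Y
  rw [Complex.normSq_apply]
  simp only [Complex.add_re, Complex.sub_re, Complex.ofReal_re,
    Complex.add_im, Complex.sub_im, Complex.ofReal_im, Complex.mul_re,
    Complex.mul_im, Complex.I_re, Complex.I_im]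
  ring

theorem normSq_exp_neg_mul (θ : ℝ) (Z : ℂ) :
    (Complex.exp (-(Complex.I * θ)) * Z).re ^ 2 + (Complex.exp (-(Complex.I * θ)) * Z).im ^ 2 =
      Complex.normSq Z := by
  have h1 : Complex.normSq (Complex.exp (-(Complex.I * θ))) = 1 := by
    rw [Complex.normSq_eq_norm_sq, show -(Complex.I * (θ : ℂ)) = ((-θ : ℝ) : ℂ) * Complex.I by
      push_cast; ring, Complex.norm_exp_ofReal_mul_I, one_pow]
  rw [show ∀ z : ℂ, z.re ^ 2 + z.im ^ 2 = Complex.normSq z from fun z => by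
    rw [Complex.normSq_apply]; ring, map_mul, h1, one_mul]

theorem norm_lt_norm_iff_normSq {z w : ℂ} : ‖z‖ < ‖w‖ ↔ Complex.normSq z < Complex.normSq w := by
  rw [Complex.normSq_eq_norm_sq, Complex.normSq_eq_norm_sq]
  exact (sq_lt_sq₀ (norm_nonneg _) (norm_nonneg _)).symm

theorem mem_fordDomain_iff (s θ t : ℝ) {c : ℂ} (hc : c ≠ 0) (Z W : ℂ) :
    ![c, c * Z, c * W] ∈ fordDomain s θ t ↔
      ‖W‖ < ‖heisCoord s θ t ![1, Z, W]‖ ∧ ‖W‖ < ‖heisCoord (-s) θ (-t) ![1, Z, W]‖ := by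
  have h : ∀ s t, ‖c * W‖ < ‖heisCoord s θ t ![c, c * Z, c * W]‖ ↔
      ‖W‖ < ‖heisCoord s θ t ![1, Z, W]‖ := fun s t => by
    rw [heisCoord_smul, norm_mul, norm_mul, mul_lt_mul_iff_right₀ (norm_pos_iff.2 hc)]
  exact and_congr (h _ _) (h _ _)

theorem mem_slab_iff (θ w c : ℝ) {a : ℂ} (ha : a ≠ 0) (Z W : ℂ) :
    ![a, a * Z, a * W] ∈ slab θ w c ↔
      |(Complex.exp (-(Complex.I * θ)) * Z).re - c| < w := by
  have hpos : 0 < Complex.normSq a := Complex.normSq_pos.2 ha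
  have e : (Complex.exp (-(Complex.I * θ)) * (a * Z) * starRingEnd ℂ a).re -
      c * Complex.normSq a = ((Complex.exp (-(Complex.I * θ)) * Z).re - c) * Complex.normSq a := by
    rw [show Complex.exp (-(Complex.I * θ)) * (a * Z) * starRingEnd ℂ a =
      (a * starRingEnd ℂ a) * (Complex.exp (-(Complex.I * θ)) * Z) by ring, Complex.mul_conj,
      Complex.re_ofReal_mul]
    ring
  change |(Complex.exp (-(Complex.I * θ)) * (a * Z) * starRingEnd ℂ a).re -
      c * Complex.normSq a| < w * Complex.normSq a ↔ _
  rw [e, abs_mul, abs_of_pos hpos, mul_lt_mul_iff_left₀ hpos]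

/-- By convexity, a negative vector outside the isometric spheres of a Heisenberg translation and of
its inverse is outside those of all nontrivial powers. -/
theorem norm_lt_norm_heisCoord_zpow {s θ t : ℝ} {n : ℤ} (hn : n ≠ 0) {v : Fin 3 → ℂ}
    (hv : v ∈ negVec) (h : v ∈ fordDomain s θ t) :
    ‖v 2‖ < ‖heisCoord (n * s) θ (n * t) v‖ := by
  obtain ⟨c, Z, W, hc, rfl, hneg⟩ := exists_normalization hv
  rw [mem_fordDomain_iff s θ t hc] at h
  obtain ⟨h1, h2⟩ := h
  change ‖c * W‖ < _
  rw [heisCoord_smul, norm_mul, norm_mul, mul_lt_mul_iff_right₀ (norm_pos_iff.2 hc)]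
  rw [norm_lt_norm_iff_normSq, normSq_heisCoord, Complex.normSq_apply] at *
  have hY := normSq_exp_neg_mul θ Z
  rw [Complex.normSq_apply] at hY
  generalize Complex.exp (-(Complex.I * θ)) * Z = Y at *
  have h2' : √2 ^ 2 = 2 := Real.sq_sqrt (by norm_num)
  have hdisc : ∀ s, (√2 * Y.re * s) ^ 2 ≤ 4 * (-W.re) * s ^ 2 := by
    intro s
    have : (√2 * Y.re * s) ^ 2 = 2 * Y.re ^ 2 * s ^ 2 := by rw [mul_pow, mul_pow, h2']
    rw [this]
    exact mul_le_mul_of_nonneg_right (by nlinarith [sq_nonneg Y.im]) (sq_nonneg s)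
  rcases lt_or_gt_of_ne hn with hn | hn
  · have hx : (1 : ℝ) ≤ -n := by exact_mod_cast (by omega : (1 : ℤ) ≤ -n)
    have := sq_add_sq_lt_of_convex (u := W.im) (δ := √2 * Y.im * s - t)
      (hdisc (-s)) hx (by linarith)
    nlinarith [this]
  · have hx : (1 : ℝ) ≤ n := by exact_mod_cast (by omega : (1 : ℤ) ≤ n)
    have := sq_add_sq_lt_of_convex (u := W.im) (δ := -(√2 * Y.im * s) + t)
      (hdisc s) hx (by linarith)
    nlinarith [this]

/-- If `v` and `heisB s θ t ^ n • v` were both in the domain, the modulus of the last coordinate would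
increase strictly from either one to the other. -/
theorem heisB_zpow_smul_notMem_fordDomain (s θ t : ℝ) (n : ℤ) (hn : n ≠ 0) (v : Fin 3 → ℂ)
    (hv : v ∈ negVec) (h : v ∈ fordDomain s θ t) : heisB s θ t ^ n • v ∉ fordDomain s θ t := by
  intro h'
  have key : ∀ (m : ℤ), m ≠ 0 → ∀ u ∈ negVec, u ∈ fordDomain s θ t →
      ‖u 2‖ < ‖(heisB s θ t ^ m • u) 2‖ := by
    intro m hm u hu hf
    rw [heisB_zpow, heisB_smul]
    exact norm_lt_norm_heisCoord_zpow hm hu hf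
  have h1 := key n hn v hv h
  have h2 := key (-n) (neg_ne_zero.2 hn) _ (smul_mem_negVec _ v hv) h'
  rw [smul_smul, ← _root_.zpow_add, neg_add_cancel, zpow_zero, one_smul] at h2
  exact lt_asymm h1 h2

theorem heisB_zpow_smul_notMem_slab {s : ℝ} (hs : 0 < s) (θ t c : ℝ) (n : ℤ) (hn : n ≠ 0)
    (v : Fin 3 → ℂ) (hv : v ∈ negVec) (h : v ∈ slab θ (s / √2) c) :
    heisB s θ t ^ n • v ∉ slab θ (s / √2) c := by
  obtain ⟨a, Z, W, ha, rfl, -⟩ := exists_normalization hv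
  have e : heisB s θ t ^ n • ![a, a * Z, a * W] =
      ![a, a * (Z + √2 * (n * s : ℝ) * Complex.exp (Complex.I * θ)),
        a * heisCoord (n * s) θ (n * t) ![1, Z, W]] := by
    rw [heisB_zpow, heisB_smul, heisCoord_smul]
    ext i
    fin_cases i <;> simp; ring
  rw [e, mem_slab_iff _ _ _ ha]
  rw [mem_slab_iff _ _ _ ha] at h
  have h' : Complex.exp (-(Complex.I * θ)) * Complex.exp (Complex.I * θ) = 1 := by
    rw [← Complex.exp_add]; simp
  have e2 : Complex.exp (-(Complex.I * θ)) *
      (Z + √2 * (n * s : ℝ) * Complex.exp (Complex.I * θ)) =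
      Complex.exp (-(Complex.I * θ)) * Z + (√2 * (n * s) : ℝ) := by
    push_cast
    linear_combination (√2 * (n * s) : ℂ) * h'
  rw [e2, Complex.add_re, Complex.ofReal_re]
  have h2' : √2 * √2 = 2 := Real.mul_self_sqrt (by norm_num)
  have hw : √2 * s = 2 * (s / √2) := by
    field_simp; linarith
  have hwpos : 0 < s / √2 := by positivity
  generalize (Complex.exp (-(Complex.I * θ)) * Z).re = x at *
  rw [show √2 * (n * s) = n * (2 * (s / √2)) by rw [← hw]; ring]
  generalize s / √2 = w at *
  rw [abs_lt] at *
  rcases lt_or_gt_of_ne hn with hn | hn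
  · have hx : (n : ℝ) ≤ -1 := by exact_mod_cast (by omega : n ≤ -1)
    rintro ⟨h3, h4⟩
    nlinarith
  · have hx : (1 : ℝ) ≤ n := by exact_mod_cast (by omega : (1 : ℤ) ≤ n)
    rintro ⟨h3, h4⟩
    nlinarith

/-! ### Two slabs -/

/-- The maximum over `α` is attained at `α = -φ / 3`; the difference of the two sides factors
through `1 - cos (α + φ / 3)`. -/
theorem cos_mul_one_add_cos_le (α : ℝ) {φ : ℝ} (h1 : -Real.pi ≤ φ) (h2 : φ ≤ Real.pi) :
    Real.cos α * (1 + Real.cos (α + φ)) ≤ 2 * Real.cos (φ / 3) ^ 3 := by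
  obtain ⟨ψ, rfl⟩ : ∃ ψ, φ = 3 * ψ := ⟨φ / 3, by ring⟩
  obtain ⟨β, rfl⟩ : ∃ β, α = β - ψ := ⟨α + ψ, by ring⟩
  rw [show β - ψ + 3 * ψ = β + 2 * ψ by ring, show 3 * ψ / 3 = ψ by ring, Real.cos_sub,
    Real.cos_add, Real.cos_two_mul, Real.sin_two_mul]
  have e1 := Real.sin_sq_add_cos_sq ψ
  have e2 := Real.sin_sq_add_cos_sq β
  have hc : 1 / 2 ≤ Real.cos ψ := by
    rw [← Real.cos_pi_div_three, ← Real.cos_abs ψ]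
    exact Real.cos_le_cos_of_nonneg_of_le_pi (abs_nonneg _) (by linarith [Real.pi_pos])
      (abs_le.2 ⟨by linarith, by linarith⟩)
  have hC := Real.neg_one_le_cos β
  have hC' := Real.cos_le_one β
  generalize Real.cos ψ = c at *
  generalize Real.sin ψ = s at *
  generalize Real.cos β = C at *
  generalize Real.sin β = S at *
  have key : 0 ≤ c * (2 + C) - s * S := by
    have h : (s * S) ^ 2 ≤ (c * (2 + C)) ^ 2 := by
      have hs : s ^ 2 ≤ 3 * c ^ 2 := by nlinarith
      have hS : 3 * S ^ 2 ≤ (2 + C) ^ 2 := by nlinarith [sq_nonneg (2 * C + 1)]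
      nlinarith [mul_le_mul_of_nonneg_right hs (sq_nonneg S),
        mul_le_mul_of_nonneg_left hS (sq_nonneg c)]
    linarith [abs_le_of_sq_le_sq h (mul_nonneg (by linarith) (by linarith)), le_abs_self (s * S)]
  have key2 := mul_nonneg (sub_nonneg.2 hC') key
  have id : 2 * c ^ 3 - (C * c + S * s) * (1 + (C * (2 * c ^ 2 - 1) - S * (2 * s * c))) =
      (1 - C) * (c * (2 + C) - s * S) := by
    linear_combination 2 * c * s ^ 2 * e2 + 2 * c * (1 - C ^ 2) * e1
  linarith

theorem abs_cos_mul_one_add_abs_cos_le (α : ℝ) {φ : ℝ} (h1 : -(Real.pi / 2) ≤ φ)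
    (h2 : φ ≤ Real.pi / 2) :
    |Real.cos α| * (1 + |Real.cos (α + φ)|) ≤ 2 * Real.cos (φ / 3) ^ 3 := by
  have hpi := Real.pi_pos
  -- Changing the sign of `cos (α + φ)` shifts `φ` by `π`, which only decreases the bound.
  have hneg : ∀ α, Real.cos α * (1 - Real.cos (α + φ)) ≤ 2 * Real.cos (φ / 3) ^ 3 := by
    intro α
    obtain ⟨φ', hφ', hlo, hhi, habs⟩ : ∃ φ', Real.cos (α + φ') = -Real.cos (α + φ) ∧
        -Real.pi ≤ φ' ∧ φ' ≤ Real.pi ∧ |φ| ≤ |φ'| := by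
      rcases le_total 0 φ with h | h
      · refine ⟨φ - Real.pi, ?_, by linarith, by linarith, ?_⟩
        · rw [show α + (φ - Real.pi) = α + φ - Real.pi by ring, Real.cos_sub_pi]
        · rw [abs_of_nonneg h, abs_of_nonpos (by linarith)]; linarith
      · refine ⟨φ + Real.pi, ?_, by linarith, by linarith, ?_⟩
        · rw [show α + (φ + Real.pi) = α + φ + Real.pi by ring, Real.cos_add_pi]
        · rw [abs_of_nonpos h, abs_of_nonneg (by linarith)]; linarith
    have h := cos_mul_one_add_cos_le α hlo hhi
    rw [hφ'] at h
    have hφpi : |φ'| ≤ Real.pi := abs_le.2 ⟨hlo, hhi⟩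
    have hle : Real.cos (φ' / 3) ≤ Real.cos (φ / 3) := by
      rw [← Real.cos_abs (φ' / 3), ← Real.cos_abs (φ / 3), abs_div, abs_div,
        abs_of_pos (show (0 : ℝ) < 3 by norm_num)]
      exact Real.cos_le_cos_of_nonneg_of_le_pi (by positivity) (by linarith) (by linarith)
    have hnn : 0 ≤ Real.cos (φ' / 3) :=
      Real.cos_nonneg_of_mem_Icc ⟨by linarith, by linarith⟩
    have := pow_le_pow_left₀ hnn hle 3
    linarith
  have hpos : ∀ α, Real.cos α * (1 + Real.cos (α + φ)) ≤ 2 * Real.cos (φ / 3) ^ 3 :=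
    fun α => cos_mul_one_add_cos_le α (by linarith) (by linarith)
  have e : ∀ α, Real.cos (α + Real.pi + φ) = -Real.cos (α + φ) := fun α => by
    rw [show α + Real.pi + φ = α + φ + Real.pi by ring, Real.cos_add_pi]
  have hpos' := hpos (α + Real.pi)
  have hneg' := hneg (α + Real.pi)
  rw [e, Real.cos_add_pi] at hpos' hneg'
  have a1 := hpos α
  have a2 := hneg α
  rcases abs_cases (Real.cos α) with ⟨h, -⟩ | ⟨h, -⟩ <;>
    rcases abs_cases (Real.cos (α + φ)) with ⟨h', -⟩ | ⟨h', -⟩ <;> rw [h, h'] <;> linarith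

/-- A slab for a translation fixing `∞` and one for a translation fixing `o` cover the negative
vectors when the product of their half widths is at least the supremum of
`|Re (exp (-iθ₁) * v 1 / v 2)| * |Re (exp (-iθ₂) * v 1 / v 0)|`, which is approached only at the
boundary of the complex hyperbolic plane. -/
theorem rev_mem_slab_of_notMem_slab {θ₁ θ₂ w₁ w₂ : ℝ} (hw₁ : 0 < w₁) (hw₂ : 0 < w₂)
    (h1 : -(Real.pi / 2) ≤ θ₁ - θ₂) (h2 : θ₁ - θ₂ ≤ Real.pi / 2)
    (hw : 2 * Real.cos ((θ₁ - θ₂) / 3) ^ 3 ≤ w₁ * w₂) {v : Fin 3 → ℂ} (hv : v ∈ negVec)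
    (h : v ∘ Fin.rev ∉ slab θ₁ w₁ 0) : v ∈ slab θ₂ w₂ 0 := by
  obtain ⟨a, Z, W, ha, rfl, hneg⟩ := exists_normalization hv
  rw [mem_slab_iff _ _ _ ha]
  by_contra h'
  have hpos : 0 < Complex.normSq a := Complex.normSq_pos.2 ha
  obtain ⟨r, η, hr, rfl⟩ : ∃ r η : ℝ, 0 ≤ r ∧ Z = r * Complex.exp (η * Complex.I) :=
    ⟨‖Z‖, Z.arg, norm_nonneg _, (Complex.norm_mul_exp_arg_mul_I Z).symm⟩
  have hexp : ∀ θ : ℝ, Complex.exp (-(Complex.I * θ)) * (r * Complex.exp (η * Complex.I)) =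
      r * Complex.exp ((η - θ : ℝ) * Complex.I) := by
    intro θ
    rw [mul_left_comm, ← Complex.exp_add]
    congr 2
    push_cast; ring
  have hre : ∀ x : ℝ, (Complex.exp (x * Complex.I)).re = Real.cos x :=
    Complex.exp_ofReal_mul_I_re
  have him : ∀ x : ℝ, (Complex.exp (x * Complex.I)).im = Real.sin x :=
    Complex.exp_ofReal_mul_I_im
  rw [hexp, Complex.re_ofReal_mul, hre, sub_zero, abs_mul, abs_of_nonneg hr, not_lt] at h'
  have h3 : w₁ * Complex.normSq W ≤
      r * |W.re * Real.cos (η - θ₁) + W.im * Real.sin (η - θ₁)| := by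
    have e : (Complex.exp (-(Complex.I * θ₁)) * (a * (r * Complex.exp (η * Complex.I))) *
        starRingEnd ℂ (a * W)).re - 0 * Complex.normSq (a * W) =
        Complex.normSq a * (r * (W.re * Real.cos (η - θ₁) + W.im * Real.sin (η - θ₁))) := by
      rw [show Complex.exp (-(Complex.I * θ₁)) * (a * (r * Complex.exp (η * Complex.I))) *
          starRingEnd ℂ (a * W) = (a * starRingEnd ℂ a) *
            ((Complex.exp (-(Complex.I * θ₁)) * (r * Complex.exp (η * Complex.I))) *
              starRingEnd ℂ W) by rw [map_mul]; ring, hexp, Complex.mul_conj,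
        Complex.re_ofReal_mul, mul_assoc, Complex.re_ofReal_mul, Complex.mul_re, hre, him,
        Complex.conj_re, Complex.conj_im]
      ring
    have h3 : ¬ |(Complex.exp (-(Complex.I * θ₁)) * (a * (r * Complex.exp (η * Complex.I))) *
        starRingEnd ℂ (a * W)).re - 0 * Complex.normSq (a * W)| <
        w₁ * Complex.normSq (a * W) := h
    rw [e, abs_mul, abs_of_pos hpos, abs_mul, abs_of_nonneg hr, map_mul,
      mul_left_comm w₁, mul_lt_mul_iff_right₀ hpos, not_lt] at h3
    exact h3
  have htrig := abs_cos_mul_one_add_abs_cos_le (η - θ₂) (φ := -(θ₁ - θ₂)) (by linarith)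
    (by linarith)
  rw [show η - θ₂ + -(θ₁ - θ₂) = η - θ₁ by ring, neg_div, Real.cos_neg] at htrig
  have hZ : Complex.normSq (r * Complex.exp (η * Complex.I)) = r ^ 2 := by
    rw [Complex.normSq_eq_norm_sq, norm_mul, Complex.norm_exp_ofReal_mul_I, mul_one,
      Complex.norm_real, Real.norm_eq_abs, sq_abs]
  rw [hZ] at hneg
  have hmr : r ^ 2 < 2 * -W.re := by linarith
  have hm : 0 < -W.re := by nlinarith [sq_nonneg r]
  have hWpos : 0 < Complex.normSq W := by
    rw [Complex.normSq_apply]; nlinarith [mul_self_nonneg W.im]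
  -- The image of the half plane `Re W ≤ -m` under inversion is a disc of radius `1 / (2 * m)`.
  have h4 : |W.re * Real.cos (η - θ₁) + W.im * Real.sin (η - θ₁)| * (2 * -W.re) ≤
      Complex.normSq W * (1 + |Real.cos (η - θ₁)|) := by
    have hsc := Real.sin_sq_add_cos_sq (η - θ₁)
    rw [Complex.normSq_apply]
    generalize Real.cos (η - θ₁) = C at *
    generalize Real.sin (η - θ₁) = S at *
    generalize W.re = x at *
    generalize W.im = y at *
    have hN : 0 ≤ x * x + y * y := add_nonneg (mul_self_nonneg x) (mul_self_nonneg y)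
    have hcs : |(y * y - x * x) * C - 2 * x * y * S| ≤ x * x + y * y := by
      apply abs_le_of_sq_le_sq _ hN
      have : ((y * y - x * x) * C - 2 * x * y * S) ^ 2 +
          ((y * y - x * x) * S + 2 * x * y * C) ^ 2 = (x * x + y * y) ^ 2 := by
        linear_combination (x * x + y * y) ^ 2 * hsc
      nlinarith [sq_nonneg ((y * y - x * x) * S + 2 * x * y * C)]
    have c1 := mul_le_mul_of_nonneg_left (le_abs_self C) hN
    have c2 := mul_le_mul_of_nonneg_left (neg_abs_le C) hN
    rw [abs_le] at hcs
    rcases abs_cases (x * C + y * S) with ⟨h, -⟩ | ⟨h, -⟩ <;> rw [h] <;> nlinarith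
  generalize |W.re * Real.cos (η - θ₁) + W.im * Real.sin (η - θ₁)| = A at *
  have hC₁ := abs_nonneg (Real.cos (η - θ₁))
  generalize |Real.cos (η - θ₁)| = C₁ at *
  have hC := abs_nonneg (Real.cos (η - θ₂))
  generalize |Real.cos (η - θ₂)| = C₂ at *
  generalize Complex.normSq W = N at *
  generalize -W.re = m at *
  have e1 : (w₁ * N) * w₂ * (2 * m) ≤ (r * A) * (r * C₂) * (2 * m) := by
    gcongr
    exact mul_nonneg hr (by nlinarith)
  have e2 : (r * r * C₂) * (A * (2 * m)) ≤ (r * r * C₂) * (N * (1 + C₁)) := by gcongr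
  have e3 : (r * r * N) * (C₂ * (1 + C₁)) ≤ (r * r * N) * (w₁ * w₂) :=
    mul_le_mul_of_nonneg_left (htrig.trans hw) (by positivity)
  have : (N * w₁ * w₂) * r ^ 2 < (N * w₁ * w₂) * (2 * m) := by gcongr
  nlinarith

/-! ### A slab and a Ford domain -/

theorem norm_neg_sq_add_I_mul (s t : ℝ) : ‖-(s : ℂ) ^ 2 + Complex.I * t‖ = heisMod s t := by
  rw [heisMod, ← Complex.norm_conj, ← norm_neg]
  congr 1
  simp [add_comm]

theorem heisMod_neg_neg (s t : ℝ) : heisMod (-s) (-t) = heisMod s t := by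
  rw [heisMod, heisMod, ← Complex.norm_conj]
  simp

theorem normSq_neg_sq_add_I_mul (s t : ℝ) :
    Complex.normSq (-(s : ℂ) ^ 2 + Complex.I * t) = heisMod s t ^ 2 := by
  rw [Complex.normSq_eq_norm_sq, norm_neg_sq_add_I_mul]

/-- The closed interior of the isometric sphere of a Heisenberg translation fixing `o` lies in the
open vertical cylinder over a disc, whose centre is the vertical projection of the preimage of `∞`;
the inequality is multiplied by the square of the modulus. -/
theorem normSq_lt_of_norm_heisCoord_le {s θ t : ℝ} (hM : 0 < heisMod s t) {Z W : ℂ}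
    (hneg : 2 * W.re + Complex.normSq Z < 0) (h : ‖heisCoord s θ t ![W, Z, 1]‖ ≤ 1) :
    Complex.normSq (starRingEnd ℂ (-(s : ℂ) ^ 2 + Complex.I * t) *
      (Complex.exp (-(Complex.I * θ)) * Z) + √2 * s) < 2 * heisMod s t := by
  have hκ := normSq_neg_sq_add_I_mul s t
  have hκn := norm_neg_sq_add_I_mul s t
  have hκre : (-(s : ℂ) ^ 2 + Complex.I * t).re = -s ^ 2 := by simp [pow_two]
  have e : heisCoord s θ t ![W, Z, 1] =
      1 - (√2 * s : ℝ) * (Complex.exp (-(Complex.I * θ)) * Z) +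
        (-(s : ℂ) ^ 2 + Complex.I * t) * W := by
    simp [heisCoord]; ring
  have hY : Complex.normSq (Complex.exp (-(Complex.I * θ)) * Z) = Complex.normSq Z := by
    rw [← normSq_exp_neg_mul θ Z, Complex.normSq_apply]; ring
  rw [e] at h
  rw [← hY] at hneg
  generalize Complex.exp (-(Complex.I * θ)) * Z = Y at *
  generalize -(s : ℂ) ^ 2 + Complex.I * t = κ at *
  have h1 : |(starRingEnd ℂ κ * (1 - (√2 * s : ℝ) * Y + κ * W)).re| ≤ heisMod s t := by
    refine (Complex.abs_re_le_norm _).trans ?_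
    rw [norm_mul, Complex.norm_conj, hκn]
    nlinarith
  have h2 : starRingEnd ℂ κ * (1 - (√2 * s : ℝ) * Y + κ * W) =
      starRingEnd ℂ κ - (√2 * s : ℝ) * (starRingEnd ℂ κ * Y) +
        (heisMod s t ^ 2 : ℝ) * W := by
    rw [← hκ, ← Complex.mul_conj]; ring
  rw [h2, Complex.add_re, Complex.sub_re, Complex.re_ofReal_mul, Complex.re_ofReal_mul,
    Complex.conj_re, hκre] at h1
  have h3 : Complex.normSq (starRingEnd ℂ κ * Y + √2 * s) =
      heisMod s t ^ 2 * Complex.normSq Y + 2 * s ^ 2 +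
        2 * (√2 * s) * (starRingEnd ℂ κ * Y).re := by
    have h2' : √2 ^ 2 = 2 := Real.sq_sqrt (by norm_num)
    rw [← hκ, ← Complex.normSq_conj κ, ← map_mul, Complex.normSq_apply, Complex.normSq_apply]
    simp only [Complex.add_re, Complex.add_im, ← Complex.ofReal_mul, Complex.ofReal_re,
      Complex.ofReal_im]
    linear_combination s ^ 2 * h2'
  rw [h3]
  have h4 := (abs_le.1 h1).1
  nlinarith [mul_pos (pow_pos hM 2) (neg_pos.2 hneg)]

/-- The open slab of half width `w` centred between the isometric spheres of a Heisenberg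
translation fixing `o` and of its inverse covers the part of the negative vectors inside them. -/
theorem exists_rev_mem_slab_of_notMem_fordDomain (θ₁ : ℝ) {w s θ t : ℝ} (hM : 0 < heisMod s t)
    (hd : 0 ≤ s ^ 3 * Real.cos (θ₁ - θ))
    (hw : √2 * (s ^ 3 * Real.cos (θ₁ - θ) / heisMod s t ^ 2) + √2 / √(heisMod s t) ≤ w) :
    ∃ c, ∀ v ∈ negVec, v ∉ fordDomain s θ t → v ∘ Fin.rev ∈ slab θ₁ w c := by
  set M := heisMod s t with hMdef
  set κ := -(s : ℂ) ^ 2 + Complex.I * t with hκdef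
  have hκ := normSq_neg_sq_add_I_mul s t
  rw [← hMdef, ← hκdef] at hκ
  set ζ := Complex.exp (-(Complex.I * ((θ₁ - θ : ℝ) : ℂ))) with hζ
  have hζ1 : Complex.normSq ζ = 1 := by
    have := normSq_exp_neg_mul (θ₁ - θ) 1
    rw [mul_one, ← hζ, Complex.normSq_one] at this
    rw [Complex.normSq_apply]; linarith
  have hζre : ζ.re = Real.cos (θ₁ - θ) := by
    rw [hζ, show -(Complex.I * ((θ₁ - θ : ℝ) : ℂ)) = ((-(θ₁ - θ) : ℝ) : ℂ) * Complex.I by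
      push_cast; ring, Complex.exp_ofReal_mul_I_re, Real.cos_neg]
  have hsplit : ∀ Z : ℂ, Complex.exp (-(Complex.I * θ₁)) * Z =
      ζ * (Complex.exp (-(Complex.I * θ)) * Z) := by
    intro Z
    rw [hζ, ← mul_assoc, ← Complex.exp_add]
    congr 2
    push_cast; ring
  -- The centre of the slab is the mean of those of the two discs.
  refine ⟨√2 * s * (ζ * (starRingEnd ℂ κ - κ)).re / (2 * M ^ 2), ?_⟩
  intro v hv hford
  obtain ⟨a, Z, W, ha, hva, hneg⟩ := exists_normalization (rev_mem_negVec hv)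
  have hv' : v = ![a * W, a * Z, a] := by
    have : v = (v ∘ Fin.rev) ∘ Fin.rev := by ext i; simp
    rw [this, hva]
    ext i
    fin_cases i <;> rfl
  rw [hva, mem_slab_iff _ _ _ ha, hsplit]
  have hdisc : ∀ s' t', heisMod s' t' = M → ¬ ‖v 2‖ < ‖heisCoord s' θ t' v‖ →
      Complex.normSq (starRingEnd ℂ (-(s' : ℂ) ^ 2 + Complex.I * t') *
        (Complex.exp (-(Complex.I * θ)) * Z) + √2 * s') < 2 * M := by
    intro s' t' hM' h'
    rw [← hM'] at hM ⊢
    refine normSq_lt_of_norm_heisCoord_le hM hneg ?_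
    rw [hv'] at h'
    have e : heisCoord s' θ t' ![a * W, a * Z, a] = a * heisCoord s' θ t' ![W, Z, 1] := by
      simp [heisCoord]; ring
    rw [e, norm_mul] at h'
    have hpos := norm_pos_iff.2 ha
    change ¬ ‖a‖ < _ at h'
    nlinarith
  -- Projecting a disc to a line in the direction of `θ₁`.
  have hproj : ∀ (κ Y : ℂ) (x : ℝ), Complex.normSq κ = M ^ 2 →
      Complex.normSq (starRingEnd ℂ κ * Y + x) < 2 * M →
      |(ζ * Y).re + x * (ζ * κ).re / M ^ 2| < √2 / √M := by
    intro κ Y x hκ h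
    have e : (ζ * Y).re + x * (ζ * κ).re / M ^ 2 =
        (ζ * κ * (starRingEnd ℂ κ * Y + x)).re / M ^ 2 := by
      rw [show ζ * κ * (starRingEnd ℂ κ * Y + x) =
        ((κ * starRingEnd ℂ κ) * (ζ * Y)) + x * (ζ * κ) by ring, Complex.mul_conj, hκ,
        Complex.add_re, Complex.re_ofReal_mul, Complex.re_ofReal_mul]
      field_simp
    rw [e]
    apply abs_lt_of_sq_lt_sq _ (by positivity)
    rw [div_pow, div_pow, Real.sq_sqrt (by norm_num), Real.sq_sqrt hM.le, div_lt_div_iff₀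
      (by positivity) hM]
    have h1 : (ζ * κ * (starRingEnd ℂ κ * Y + x)).re ^ 2 ≤
        Complex.normSq (ζ * κ * (starRingEnd ℂ κ * Y + x)) := by
      rw [Complex.normSq_apply]; nlinarith [mul_self_nonneg
        (ζ * κ * (starRingEnd ℂ κ * Y + x)).im]
    rw [map_mul, map_mul, hζ1, hκ, one_mul] at h1
    have h2 : M ^ 2 * Complex.normSq (starRingEnd ℂ κ * Y + x) < M ^ 2 * (2 * M) := by gcongr
    nlinarith
  have hcos : (ζ * (κ + starRingEnd ℂ κ)).re = -(2 * s ^ 2 * Real.cos (θ₁ - θ)) := by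
    have : κ + starRingEnd ℂ κ = ((-(2 * s ^ 2) : ℝ) : ℂ) := by
      rw [Complex.add_conj]
      simp [hκdef, pow_two]
    rw [this, mul_comm, Complex.re_ofReal_mul, hζre]
    ring
  rw [mul_add, Complex.add_re] at hcos
  rw [mul_sub, Complex.sub_re]
  set Y := Complex.exp (-(Complex.I * θ)) * Z
  set d := √2 * (s ^ 3 * Real.cos (θ₁ - θ) / M ^ 2) with hddef
  have hd0 : 0 ≤ d := by positivity
  have hnot : ¬ ‖v 2‖ < ‖heisCoord s θ t v‖ ∨ ¬ ‖v 2‖ < ‖heisCoord (-s) θ (-t) v‖ :=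
    not_and_or.1 hford
  set p := (ζ * κ).re
  set q := (ζ * starRingEnd ℂ κ).re with hq
  rw [abs_lt]
  rcases hnot with h | h
  · have h1 := hproj κ Y (√2 * s) hκ (by
      have := hdisc s t rfl h
      rwa [← hκdef, ← Complex.ofReal_mul] at this)
    rw [abs_lt] at h1
    have e : (ζ * Y).re - √2 * s * (q - p) / (2 * M ^ 2) =
        ((ζ * Y).re + √2 * s * p / M ^ 2) + d := by
      rw [hddef]
      field_simp
      linear_combination (-√2 * s) * hcos
    rw [e]
    constructor <;> linarith
  · have h1 := hproj (starRingEnd ℂ κ) Y (√2 * (-s)) (by rw [Complex.normSq_conj, hκ]) (by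
      have := hdisc (-s) (-t) (heisMod_neg_neg s t) h
      have hc : starRingEnd ℂ κ = -(((-s : ℝ) : ℂ)) ^ 2 + Complex.I * ((-t : ℝ) : ℂ) := by
        simp [hκdef]
      rwa [← hc, ← Complex.ofReal_mul] at this)
    rw [abs_lt, ← hq] at h1
    have e : (ζ * Y).re - √2 * s * (q - p) / (2 * M ^ 2) =
        ((ζ * Y).re + √2 * (-s) * q / M ^ 2) - d := by
      rw [hddef]
      field_simp
      linear_combination √2 * s * hcos
    rw [e]
    constructor <;> linarith

/-- A slab meets the outside of the isometric spheres: the centre line of the slab ends at `∞`. -/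
theorem exists_mem_fordDomain_rev_mem_slab (θ₁ : ℝ) {w : ℝ} (hw : 0 < w) (c : ℝ) (θ : ℝ) {s t : ℝ}
    (hM : 0 < heisMod s t) : ∃ p ∈ negVec, p ∈ fordDomain s θ t ∧ p ∘ Fin.rev ∈ slab θ₁ w c := by
  set Z : ℂ := c * Complex.exp (Complex.I * θ₁)
  -- Points with large `K` are close to `∞`, which the isometric spheres of `heisB` do not enclose.
  obtain ⟨K, hK1, hK2⟩ : ∃ K : ℝ, c ^ 2 < 2 * K ∧
      2 + ‖(√2 * s * Complex.exp (-(Complex.I * θ)) * Z : ℂ)‖ < heisMod s t * K := by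
    refine ⟨max (c ^ 2 + 1)
      ((3 + ‖(√2 * s * Complex.exp (-(Complex.I * θ)) * Z : ℂ)‖) / heisMod s t), ?_, ?_⟩
    · nlinarith [le_max_left (c ^ 2 + 1)
        ((3 + ‖(√2 * s * Complex.exp (-(Complex.I * θ)) * Z : ℂ)‖) / heisMod s t), sq_nonneg c]
    · have := mul_le_mul_of_nonneg_left (le_max_right (c ^ 2 + 1)
        ((3 + ‖(√2 * s * Complex.exp (-(Complex.I * θ)) * Z : ℂ)‖) / heisMod s t)) hM.le
      rw [mul_div_cancel₀ _ hM.ne'] at this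
      linarith
  have hK : 0 < K := by nlinarith [sq_nonneg c]
  have hford : ∀ s' t', heisMod s' t' = heisMod s t → |s'| = |s| →
      ‖(1 : ℂ)‖ < ‖heisCoord s' θ t' ![-(K : ℂ), Z, 1]‖ := by
    intro s' t' hM' hs'
    have e : heisCoord s' θ t' ![-(K : ℂ), Z, 1] =
        (1 - √2 * s' * Complex.exp (-(Complex.I * θ)) * Z) -
          (-(s' : ℂ) ^ 2 + Complex.I * t') * K := by
      simp [heisCoord]; ring
    have hn : ‖(√2 * s' * Complex.exp (-(Complex.I * θ)) * Z : ℂ)‖ =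
        ‖(√2 * s * Complex.exp (-(Complex.I * θ)) * Z : ℂ)‖ := by
      simp only [norm_mul, Complex.norm_real, Real.norm_eq_abs, hs']
    have h1 := norm_sub_norm_le ((-(s' : ℂ) ^ 2 + Complex.I * t') * K)
      (1 - √2 * s' * Complex.exp (-(Complex.I * θ)) * Z)
    have h2 := norm_sub_le (1 : ℂ) (√2 * s' * Complex.exp (-(Complex.I * θ)) * Z)
    rw [norm_mul, norm_neg_sq_add_I_mul, hM', Complex.norm_real, Real.norm_eq_abs,
      abs_of_pos hK] at h1
    rw [hn, norm_one] at h2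
    rw [e, norm_sub_rev, norm_one]
    linarith
  refine ⟨![-(K : ℂ), Z, 1], ?_, ⟨hford s t rfl rfl,
    hford (-s) (-t) (heisMod_neg_neg s t) (abs_neg s)⟩, ?_⟩
  · have hZ : Complex.normSq Z = c ^ 2 := by
      rw [Complex.normSq_eq_norm_sq, norm_mul, mul_comm Complex.I, Complex.norm_exp_ofReal_mul_I,
        mul_one, Complex.norm_real, Real.norm_eq_abs, sq_abs]
    change 2 * ((1 : ℂ) * starRingEnd ℂ (-(K : ℂ))).re + Complex.normSq Z < 0
    rw [hZ]
    simp
    linarith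
  · have e : (![-(K : ℂ), Z, 1] : Fin 3 → ℂ) ∘ Fin.rev = ![1, 1 * Z, 1 * -(K : ℂ)] := by
      ext i
      fin_cases i <;> simp
    have h' : Complex.exp (-(Complex.I * θ₁)) * Z = c := by
      rw [mul_left_comm, ← Complex.exp_add]
      simp
    rw [e, mem_slab_iff _ _ _ one_ne_zero, h']
    simpa using hw

/-! ### Two Ford domains -/

/-- The critical point of the quartic in `b` is found with Cardano's formula: for `s = x ^ 3` and
`t = 3 * x ^ 4 * d + 4 * d ^ 3` the minimum is attained at `b = x * d`. -/
theorem quartic_lower_bound (x d b : ℝ) :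
    (x ^ 4 + 4 * d ^ 2) ^ 3 / 16 ≤
      (b ^ 2 + (x ^ 3) ^ 2 / 4) ^ 2 + ((3 * x ^ 4 * d + 4 * d ^ 3) / 2 - x ^ 3 * b) ^ 2 := by
  have id : (b ^ 2 + (x ^ 3) ^ 2 / 4) ^ 2 + ((3 * x ^ 4 * d + 4 * d ^ 3) / 2 - x ^ 3 * b) ^ 2 -
      (x ^ 4 + 4 * d ^ 2) ^ 3 / 16 =
      (b - x * d) ^ 2 * ((b + x * d) ^ 2 + 2 * (x * d) ^ 2 + 3 / 2 * (x ^ 3) ^ 2) := by ring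
  have : 0 ≤ (b - x * d) ^ 2 * ((b + x * d) ^ 2 + 2 * (x * d) ^ 2 + 3 / 2 * (x ^ 3) ^ 2) := by
    positivity
  linarith

/-- The sum of cube roots `(1 - t / |s² + it|) ^ (1/3) + (1 + t / |s² + it|) ^ (1/3)`, which governs
the largest Cygan ball around the origin disjoint from its translates by `(s e^{iθ}, t)`. -/
noncomputable def cubeRootSum (s t : ℝ) : ℝ :=
  (1 - t / heisMod s t) ^ (1 / 3 : ℝ) + (1 + t / heisMod s t) ^ (1 / 3 : ℝ)

theorem abs_le_heisMod (s t : ℝ) : |t| ≤ heisMod s t := by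
  refine abs_le_of_sq_le_sq ?_ (show 0 ≤ heisMod s t from norm_nonneg _)
  rw [heisMod_sq]
  nlinarith [sq_nonneg (s ^ 2)]

theorem cubeRootSum_pos {s t : ℝ} (hM : 0 < heisMod s t) : 0 < cubeRootSum s t := by
  have h := abs_le.1 (abs_le_heisMod s t)
  have h1 : -1 ≤ t / heisMod s t := by rw [le_div_iff₀ hM]; linarith
  have h2 : t / heisMod s t ≤ 1 := by rw [div_le_one hM]; exact h.2
  unfold cubeRootSum
  rcases le_total 0 (t / heisMod s t) with h0 | h0
  · exact add_pos_of_nonneg_of_pos (Real.rpow_nonneg (by linarith) _)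
      (Real.rpow_pos_of_pos (by linarith) _)
  · exact add_pos_of_pos_of_nonneg (Real.rpow_pos_of_pos (by linarith) _)
      (Real.rpow_nonneg (by linarith) _)

theorem heisMod_sq_div_cubeRootSum_le {s t : ℝ} (hs : 0 ≤ s) (hM : 0 < heisMod s t) (b : ℝ) :
    heisMod s t ^ 2 / (2 * cubeRootSum s t ^ 3) ≤ (b ^ 2 + s ^ 2 / 4) ^ 2 + (t / 2 - s * b) ^ 2 := by
  have hroot : ∀ y : ℝ, 0 ≤ y → ∃ x : ℝ, 0 ≤ x ∧ x ^ 3 = y ∧ x = y ^ (1 / 3 : ℝ) := by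
    intro y hy
    refine ⟨y ^ (1 / 3 : ℝ), Real.rpow_nonneg hy _, ?_, rfl⟩
    rw [← Real.rpow_natCast, ← Real.rpow_mul hy]
    norm_num
  have hsq := heisMod_sq s t
  have habs := abs_le.1 (abs_le_heisMod s t)
  have hcpos := cubeRootSum_pos hM
  have h1 : 0 ≤ 1 - t / heisMod s t := by rw [sub_nonneg, div_le_one hM]; exact habs.2
  have h2 : 0 ≤ 1 + t / heisMod s t := by
    have : -1 ≤ t / heisMod s t := by rw [le_div_iff₀ hM]; linarith
    linarith
  obtain ⟨q, hq0, hq, hq'⟩ := hroot _ h1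
  obtain ⟨p, hp0, hp, hp'⟩ := hroot _ h2
  obtain ⟨m, hm0, hm, -⟩ := hroot _ hM.le
  obtain ⟨x, hx0, hx, -⟩ := hroot _ hs
  have hc : cubeRootSum s t = q + p := by rw [hq', hp']; rfl
  rw [hc] at hcpos ⊢
  rw [← hm] at hsq hq hp hM ⊢
  have hm0' : 0 < m := by
    rcases hm0.lt_or_eq with h | h
    · exact h
    · rw [← h] at hM; norm_num at hM
  have ht : t = m ^ 3 * (p ^ 3 - q ^ 3) / 2 := by
    rw [hp, hq]; field_simp; ring
  have hsum : p ^ 3 + q ^ 3 = 2 := by rw [hp, hq]; ring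
  -- The products of `m` with `p` and `q` are the cube roots of `heisMod s t ± t`, whose product is
  -- the cube root of `s ^ 4`.
  have hxpq : x ^ 4 = m ^ 2 * p * q := by
    have : (x ^ 4) ^ 3 = (m ^ 2 * p * q) ^ 3 := by
      have h4 : s ^ 4 = (m ^ 3) ^ 2 - t ^ 2 := by linarith
      rw [← hx] at h4
      calc (x ^ 4) ^ 3 = (x ^ 3) ^ 4 := by ring
        _ = m ^ 6 * (1 - ((p ^ 3 - q ^ 3) / 2) ^ 2) := by rw [h4, ht]; ring
        _ = m ^ 6 * (((p ^ 3 + q ^ 3) / 2) ^ 2 - ((p ^ 3 - q ^ 3) / 2) ^ 2) := by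
          rw [hsum]; norm_num
        _ = (m ^ 2 * p * q) ^ 3 := by ring
    exact (pow_left_inj₀ (by positivity) (by positivity) (by norm_num)).1 this
  have key := quartic_lower_bound x (m * (p - q) / 2) b
  have ht' : 3 * x ^ 4 * (m * (p - q) / 2) + 4 * (m * (p - q) / 2) ^ 3 = t := by
    rw [hxpq, ht]; ring
  rw [ht', hx] at key
  refine le_trans (le_of_eq ?_) key
  rw [hxpq, div_eq_div_iff (by positivity) (by norm_num)]
  have h3 : (m ^ 2 * p * q + 4 * (m * (p - q) / 2) ^ 2) * (q + p) = m ^ 2 * 2 := by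
    linear_combination m ^ 2 * hsum
  calc (m ^ 3) ^ 2 * 16 = 2 * (m ^ 2 * 2) ^ 3 := by ring
    _ = _ := by rw [← h3]; ring

/-- The closed insides of the isometric spheres of a Heisenberg translation fixing `o` and of its
inverse lie strictly on the side `|v 2| > ρ * |v 0|` of the sphere of points with
`|v 2| = ρ * |v 0|`, where `ρ ^ 2` is the constant on the left. -/
theorem normSq_lt_of_notMem_fordDomain {s θ t : ℝ} (hs : 0 ≤ s) (hM : 0 < heisMod s t)
    {v : Fin 3 → ℂ} (hv : v ∈ negVec) (h : v ∉ fordDomain s θ t) :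
    heisMod s t ^ 2 / (2 * cubeRootSum s t ^ 3) * Complex.normSq (v 0) < Complex.normSq (v 2) := by
  obtain ⟨a, Z, W, ha, rfl, hneg⟩ := exists_normalization hv
  rw [mem_fordDomain_iff _ _ _ ha, not_and_or] at h
  change _ * Complex.normSq a < Complex.normSq (a * W)
  rw [map_mul, mul_comm]
  refine mul_lt_mul_of_pos_left ?_ (Complex.normSq_pos.2 ha)
  have hY := normSq_exp_neg_mul θ Z
  have h2' : √2 ^ 2 = 2 := Real.sq_sqrt (by norm_num)
  -- Both last coordinates have squared modulus at most `α ^ 2 + u ^ 2`; compare with the squares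
  -- of the mean of the real parts and of half the difference of the imaginary parts.
  have hmean : ∀ {α x y s u t : ℝ}, x ^ 2 + y ^ 2 < 2 * α →
      (α + √2 * x * s + s ^ 2) ^ 2 + (u - √2 * y * s + t) ^ 2 ≤ α ^ 2 + u ^ 2 →
      ((y / √2) ^ 2 + s ^ 2 / 4) ^ 2 + (t / 2 - s * (y / √2)) ^ 2 < α ^ 2 + u ^ 2 := by
    intro α x y s u t hα h
    obtain ⟨x, rfl⟩ : ∃ x', x = √2 * x' := ⟨x / √2, by field_simp⟩
    obtain ⟨y, rfl⟩ : ∃ y', y = √2 * y' := ⟨y / √2, by field_simp⟩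
    rw [mul_div_cancel_left₀ _ (by positivity)]
    have e1 : ∀ z s : ℝ, √2 * (√2 * z) * s = 2 * z * s := fun z s => by
      linear_combination z * s * h2'
    rw [e1, e1] at h
    rw [mul_pow, mul_pow, h2'] at hα
    have hlt : y ^ 2 + s ^ 2 / 4 < α + x * s + s ^ 2 / 2 := by nlinarith [sq_nonneg (x + s / 2)]
    have hsq : (y ^ 2 + s ^ 2 / 4) ^ 2 < (α + x * s + s ^ 2 / 2) ^ 2 := by gcongr
    nlinarith [sq_nonneg (2 * x * s + s ^ 2), sq_nonneg (u - y * s + t / 2)]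
  rw [norm_lt_norm_iff_normSq, norm_lt_norm_iff_normSq, normSq_heisCoord, normSq_heisCoord,
    Complex.normSq_apply W, not_lt, not_lt] at h
  rw [← hY] at hneg
  rw [Complex.normSq_apply W]
  generalize Complex.exp (-(Complex.I * θ)) * Z = Y at *
  have hb := heisMod_sq_div_cubeRootSum_le hs hM (Y.im / √2)
  rcases h with h | h
  · have := hmean (α := -W.re) (x := Y.re) (y := Y.im) (s := s) (u := W.im) (t := t)
      (by linarith) (by linarith)
    linarith
  · have := hmean (α := -W.re) (x := Y.re) (y := Y.im) (s := -s) (u := W.im) (t := -t)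
      (by linarith) (by linarith)
    nlinarith

/-! ### Discreteness and freeness -/

theorem heisMod_pos {s θ t : ℝ} (h : ((s * Complex.exp (Complex.I * θ) : ℂ), t) ≠ (0, 0)) :
    0 < heisMod s t := by
  refine lt_of_le_of_ne (norm_nonneg _) fun h0 => h ?_
  have h1 := heisMod_sq s t
  rw [← h0] at h1
  have hs : s = 0 := by
    have : s ^ 4 = 0 := by nlinarith [sq_nonneg (s ^ 2), sq_nonneg t]
    exact pow_eq_zero_iff (by norm_num) |>.1 this
  have ht : t = 0 := by
    have : t ^ 2 = 0 := by nlinarith [sq_nonneg (s ^ 2), sq_nonneg t]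
    exact pow_eq_zero_iff (by norm_num) |>.1 this
  simp [hs, ht]

/-- The combination theorem for a pair of Heisenberg translations, with domains given in the
coordinates in which the respective translation fixes `o`. -/
theorem discrete_and_free_of_heis_domains (s₁ θ₁ t₁ s₂ θ₂ t₂ : ℝ) {P Q : Set (Fin 3 → ℂ)}
    (hP : IsOpen P) (hQ : IsOpen Q) (hcov : ∀ v ∈ negVec, v ∘ Fin.rev ∉ P → v ∈ Q)
    (ha : ∀ n : ℤ, n ≠ 0 → ∀ v ∈ negVec, v ∈ P → heisB s₁ θ₁ t₁ ^ n • v ∉ P)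
    (hb : ∀ n : ℤ, n ≠ 0 → ∀ v ∈ negVec, v ∈ Q → heisB s₂ θ₂ t₂ ^ n • v ∉ Q)
    {p : Fin 3 → ℂ} (hp : p ∈ negVec) (hpP : p ∘ Fin.rev ∈ P) (hpQ : p ∈ Q) :
    DiscreteTopology
        (Subgroup.closure ({heisA s₁ θ₁ t₁, heisB s₂ θ₂ t₂} : Set SU21)) ∧
      Function.Injective (FreeGroup.lift ![heisA s₁ θ₁ t₁, heisB s₂ θ₂ t₂]) := by
  refine discrete_and_free_of_domains _ _ (P := {v | v ∘ Fin.rev ∈ P})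
    (hP.preimage (f := fun v : Fin 3 → ℂ => v ∘ Fin.rev) (by fun_prop)) hQ hcov ?_ hb hp hpP hpQ
  intro n hn v hv hvP h
  rw [Set.mem_ofPred_eq, heisA_zpow_smul] at h
  refine ha n hn _ (rev_mem_negVec hv) hvP ?_
  convert h using 1
  ext i
  simp

theorem mem_negVec_neg_one_zero_one : (![-1, 0, 1] : Fin 3 → ℂ) ∈ negVec := by
  simp [negVec]

theorem one_lt_norm_one_add {s t : ℝ} (hM : 0 < heisMod s t) :
    1 < ‖1 - (-(s : ℂ) ^ 2 + Complex.I * t)‖ := by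
  have h1 : Complex.normSq (1 - (-(s : ℂ) ^ 2 + Complex.I * t)) =
      1 + 2 * s ^ 2 + heisMod s t ^ 2 := by
    rw [heisMod_sq]
    simp [Complex.normSq_apply, pow_two]
    ring
  rw [Complex.normSq_eq_norm_sq] at h1
  nlinarith [sq_nonneg s, pow_pos hM 2, norm_nonneg (1 - (-(s : ℂ) ^ 2 + Complex.I * t))]

/-- Both signs of the vector are needed, as reversing the coordinates of one gives the other. -/
theorem neg_one_zero_one_mem_fordDomain {s t : ℝ} (θ : ℝ) (hM : 0 < heisMod s t) {a : ℂ}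
    (ha : a = 1 ∨ a = -1) : ![-a, 0, a] ∈ fordDomain s θ t := by
  have hna : ‖a‖ = 1 := by rcases ha with rfl | rfl <;> simp
  have h : ∀ s t, 0 < heisMod s t → ‖a‖ < ‖heisCoord s θ t ![-a, 0, a]‖ := fun s t hM => by
    have e : heisCoord s θ t ![-a, 0, a] = a * (1 - (-(s : ℂ) ^ 2 + Complex.I * t)) := by
      simp [heisCoord]; ring
    rw [e, norm_mul, hna, one_mul]
    exact one_lt_norm_one_add hM
  exact ⟨h s t hM, h (-s) (-t) (by rwa [heisMod_neg_neg])⟩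

/-- Under the condition for a slab and two isometric spheres, the two domains cover the negative
vectors and intersect. -/
theorem exists_slab_cover_and_inter_fordDomain {s₁ θ₁ s₂ θ₂ t₂ : ℝ} (hs₁ : 0 < s₁)
    (hM : 0 < heisMod s₂ t₂) (hd : 0 ≤ s₂ ^ 3 * Real.cos (θ₁ - θ₂))
    (h : 2 * s₂ ^ 3 / heisMod s₂ t₂ ^ (3 / 2 : ℝ) * Real.cos (θ₁ - θ₂) + 2 ≤
      s₁ * heisMod s₂ t₂ ^ (1 / 2 : ℝ)) :
    ∃ c, (∀ v ∈ negVec, v ∉ fordDomain s₂ θ₂ t₂ → v ∘ Fin.rev ∈ slab θ₁ (s₁ / √2) c) ∧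
      ∃ p ∈ negVec, p ∈ fordDomain s₂ θ₂ t₂ ∧ p ∘ Fin.rev ∈ slab θ₁ (s₁ / √2) c := by
  have hw : √2 * (s₂ ^ 3 * Real.cos (θ₁ - θ₂) / heisMod s₂ t₂ ^ 2) + √2 / √(heisMod s₂ t₂) ≤
      s₁ / √2 := by
    have e1 : heisMod s₂ t₂ ^ (1 / 2 : ℝ) = √(heisMod s₂ t₂) := (Real.sqrt_eq_rpow _).symm
    have e2 : heisMod s₂ t₂ ^ (3 / 2 : ℝ) = √(heisMod s₂ t₂) ^ 3 := by
      rw [Real.sqrt_eq_rpow, ← Real.rpow_natCast, ← Real.rpow_mul hM.le]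
      norm_num
    rw [e1, e2] at h
    have e3 : heisMod s₂ t₂ = √(heisMod s₂ t₂) ^ 2 := (Real.sq_sqrt hM.le).symm
    have hpos := Real.sqrt_pos.2 hM
    rw [show heisMod s₂ t₂ ^ 2 = √(heisMod s₂ t₂) ^ 4 by nth_rw 1 [e3]; ring]
    generalize √(heisMod s₂ t₂) = r at *
    have h2 : √2 * √2 = 2 := Real.mul_self_sqrt (by norm_num)
    rw [le_div_iff₀ (by positivity)]
    have e4 : (√2 * (s₂ ^ 3 * Real.cos (θ₁ - θ₂) / r ^ 4) + √2 / r) * √2 =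
        (2 * s₂ ^ 3 / r ^ 3 * Real.cos (θ₁ - θ₂) + 2) / r := by
      field_simp
      linear_combination h2
    rw [e4, div_le_iff₀ hpos]
    exact h
  obtain ⟨c, hc⟩ := exists_rev_mem_slab_of_notMem_fordDomain θ₁ hM hd hw
  exact ⟨c, hc, exists_mem_fordDomain_rev_mem_slab θ₁ (by positivity) c θ₂ hM⟩

/-- The product of the squared bounds for the two spheres of points with `|v 2| = ρ * |v 0|` is at
least `1`, so that the insides of the isometric spheres of the two translations are disjoint. -/
theorem one_le_of_cubeRootSum_le {s₁ t₁ s₂ t₂ : ℝ} (hM₁ : 0 < heisMod s₁ t₁)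
    (hM₂ : 0 < heisMod s₂ t₂)
    (h : 2 ^ (1 / 2 : ℝ) * cubeRootSum s₂ t₂ ^ (3 / 4 : ℝ) * cubeRootSum s₁ t₁ ^ (3 / 4 : ℝ) ≤
      heisMod s₁ t₁ ^ (1 / 2 : ℝ) * heisMod s₂ t₂ ^ (1 / 2 : ℝ)) :
    1 ≤ heisMod s₁ t₁ ^ 2 / (2 * cubeRootSum s₁ t₁ ^ 3) *
      (heisMod s₂ t₂ ^ 2 / (2 * cubeRootSum s₂ t₂ ^ 3)) := by
  have hc₁ := cubeRootSum_pos hM₁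
  have hc₂ := cubeRootSum_pos hM₂
  have h4 := pow_le_pow_left₀ (by positivity) h 4
  have e1 : ∀ x : ℝ, 0 ≤ x → (x ^ (1 / 2 : ℝ)) ^ 4 = x ^ 2 := fun x hx => by
    rw [← Real.rpow_natCast, ← Real.rpow_mul hx, ← Real.rpow_natCast]; norm_num
  have e2 : ∀ x : ℝ, 0 ≤ x → (x ^ (3 / 4 : ℝ)) ^ 4 = x ^ 3 := fun x hx => by
    rw [← Real.rpow_natCast, ← Real.rpow_mul hx, ← Real.rpow_natCast]; norm_num
  rw [mul_pow, mul_pow, mul_pow, e1 _ (by norm_num), e1 _ hM₁.le, e1 _ hM₂.le, e2 _ hc₁.le,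
    e2 _ hc₂.le] at h4
  rw [div_mul_div_comm, le_div_iff₀ (by positivity)]
  linarith

theorem theorem1p2 (s₁ θ₁ t₁ s₂ θ₂ t₂ : ℝ)
    (hs₁ : 0 ≤ s₁) (hs₂ : 0 ≤ s₂)
    (hA : ((s₁ * Complex.exp (Complex.I * θ₁) : ℂ), t₁) ≠ (0, 0))
    (hB : ((s₂ * Complex.exp (Complex.I * θ₂) : ℂ), t₂) ≠ (0, 0))
    (hθ : s₁ ≠ 0 → s₂ ≠ 0 → -(Real.pi / 2) ≤ θ₁ - θ₂ ∧ θ₁ - θ₂ ≤ Real.pi / 2)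
    (hcond :
      -- condition (1)
      (heisMod s₁ t₁ ^ (1 / 2 : ℝ) * heisMod s₂ t₂ ^ (1 / 2 : ℝ) ≥
        2 ^ (1 / 2 : ℝ) *
          ((1 - t₂ / heisMod s₂ t₂) ^ (1 / 3 : ℝ) +
            (1 + t₂ / heisMod s₂ t₂) ^ (1 / 3 : ℝ)) ^ (3 / 4 : ℝ) *
          ((1 - t₁ / heisMod s₁ t₁) ^ (1 / 3 : ℝ) +
            (1 + t₁ / heisMod s₁ t₁) ^ (1 / 3 : ℝ)) ^ (3 / 4 : ℝ)) ∨
      -- condition (2)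
      (s₁ ≠ 0 ∧ s₁ * heisMod s₂ t₂ ^ (1 / 2 : ℝ) ≥
        if s₂ ≠ 0 then
          2 * s₂ ^ 3 / heisMod s₂ t₂ ^ (3 / 2 : ℝ) * Real.cos (θ₁ - θ₂) + 2
        else 2) ∨
      -- condition (3)
      (s₂ ≠ 0 ∧ heisMod s₁ t₁ ^ (1 / 2 : ℝ) * s₂ ≥
        if s₁ ≠ 0 then
          2 * s₁ ^ 3 / heisMod s₁ t₁ ^ (3 / 2 : ℝ) * Real.cos (θ₁ - θ₂) + 2
        else 2) ∨
      -- condition (4)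
      ((s₁ ≠ 0 ∧ s₂ ≠ 0) ∧ s₁ * s₂ ≥ 4 * Real.cos ((θ₁ - θ₂) / 3) ^ 3)) :
    DiscreteTopology
        (Subgroup.closure ({heisA s₁ θ₁ t₁, heisB s₂ θ₂ t₂} : Set SU21)) ∧
      Function.Injective (FreeGroup.lift ![heisA s₁ θ₁ t₁, heisB s₂ θ₂ t₂]) := by
  have hM₁ := heisMod_pos hA
  have hM₂ := heisMod_pos hB
  -- For `s = 0` the angle plays no role, as the cosine has the coefficient `0`.
  have hcos : s₁ ≠ 0 → s₂ ≠ 0 → 0 ≤ Real.cos (θ₁ - θ₂) := fun h1 h2 =>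
    Real.cos_nonneg_of_mem_Icc (hθ h1 h2)
  rcases hcond with h | ⟨hs, h⟩ | ⟨hs, h⟩ | ⟨⟨h1, h2⟩, h⟩
  · have hk := one_le_of_cubeRootSum_le hM₁ hM₂ h
    refine discrete_and_free_of_heis_domains s₁ θ₁ t₁ s₂ θ₂ t₂ (isOpen_fordDomain s₁ θ₁ t₁)
      (isOpen_fordDomain s₂ θ₂ t₂) ?_ (heisB_zpow_smul_notMem_fordDomain s₁ θ₁ t₁)
      (heisB_zpow_smul_notMem_fordDomain s₂ θ₂ t₂) mem_negVec_neg_one_zero_one ?_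
      (neg_one_zero_one_mem_fordDomain θ₂ hM₂ (Or.inl rfl))
    · intro v hv h1
      by_contra h2
      have k1 := normSq_lt_of_notMem_fordDomain hs₁ hM₁ (rev_mem_negVec hv) h1
      have k2 := normSq_lt_of_notMem_fordDomain hs₂ hM₂ hv h2
      change _ * Complex.normSq (v 2) < Complex.normSq (v 0) at k1
      -- `k1` and `k2` say that `c₁ * |v 2| ^ 2 < |v 0| ^ 2` and `c₂ * |v 0| ^ 2 < |v 2| ^ 2`,
      -- while `1 ≤ c₁ * c₂`.
      have hpos : 0 < heisMod s₁ t₁ ^ 2 / (2 * cubeRootSum s₁ t₁ ^ 3) := by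
        have := cubeRootSum_pos hM₁
        positivity
      nlinarith [mul_lt_mul_of_pos_left k2 hpos,
        mul_le_mul_of_nonneg_right hk (Complex.normSq_nonneg (v 0))]
    · convert neg_one_zero_one_mem_fordDomain θ₁ hM₁ (a := -1) (Or.inr rfl) using 1
      ext i
      fin_cases i <;> simp
  · have hs' : 0 < s₁ := lt_of_le_of_ne hs₁ (Ne.symm hs)
    obtain ⟨c, hc, p, hp, hpQ, hpP⟩ := exists_slab_cover_and_inter_fordDomain (θ₁ := θ₁)
      (θ₂ := θ₂) hs' hM₂
      (by
        by_cases h2 : s₂ = 0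
        · simp [h2]
        · exact mul_nonneg (pow_nonneg hs₂ 3) (hcos hs h2))
      (by
        by_cases h2 : s₂ = 0
        · simpa [h2] using h
        · simpa [h2] using h)
    exact discrete_and_free_of_heis_domains s₁ θ₁ t₁ s₂ θ₂ t₂ (isOpen_slab θ₁ (s₁ / √2) c)
      (isOpen_fordDomain s₂ θ₂ t₂) (fun v hv h => by_contra fun h' => h (hc v hv h'))
      (heisB_zpow_smul_notMem_slab hs' θ₁ t₁ c) (heisB_zpow_smul_notMem_fordDomain s₂ θ₂ t₂)
      hp hpP hpQ
  · have hs' : 0 < s₂ := lt_of_le_of_ne hs₂ (Ne.symm hs)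
    have hsymm : Real.cos (θ₂ - θ₁) = Real.cos (θ₁ - θ₂) := by rw [← Real.cos_neg, neg_sub]
    obtain ⟨c, hc, p, hp, hpP, hpQ⟩ := exists_slab_cover_and_inter_fordDomain (θ₁ := θ₂)
      (θ₂ := θ₁) hs' hM₁
      (by
        by_cases h1 : s₁ = 0
        · simp [h1]
        · rw [hsymm]
          exact mul_nonneg (pow_nonneg hs₁ 3) (hcos h1 hs))
      (by
        rw [hsymm, mul_comm s₂]
        by_cases h1 : s₁ = 0
        · simpa [h1] using h
        · simpa [h1] using h)
    have hrev : ∀ u : Fin 3 → ℂ, (u ∘ Fin.rev) ∘ Fin.rev = u := fun u => by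
      ext i; simp
    refine discrete_and_free_of_heis_domains s₁ θ₁ t₁ s₂ θ₂ t₂ (isOpen_fordDomain s₁ θ₁ t₁)
      (isOpen_slab θ₂ (s₂ / √2) c) ?_ (heisB_zpow_smul_notMem_fordDomain s₁ θ₁ t₁)
      (heisB_zpow_smul_notMem_slab hs' θ₂ t₂ c) (rev_mem_negVec hp) (by rwa [hrev]) hpQ
    intro v hv h
    simpa [hrev] using hc _ (rev_mem_negVec hv) h
  · have h1' : 0 < s₁ := lt_of_le_of_ne hs₁ (Ne.symm h1)
    have h2' : 0 < s₂ := lt_of_le_of_ne hs₂ (Ne.symm h2)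
    have hsq : √2 * √2 = 2 := Real.mul_self_sqrt (by norm_num)
    refine discrete_and_free_of_heis_domains s₁ θ₁ t₁ s₂ θ₂ t₂ (isOpen_slab θ₁ (s₁ / √2) 0)
      (isOpen_slab θ₂ (s₂ / √2) 0) ?_ (heisB_zpow_smul_notMem_slab h1' θ₁ t₁ 0)
      (heisB_zpow_smul_notMem_slab h2' θ₂ t₂ 0) mem_negVec_neg_one_zero_one ?_ ?_
    · intro v hv
      refine rev_mem_slab_of_notMem_slab (by positivity) (by positivity) (hθ h1 h2).1
        (hθ h1 h2).2 ?_ hv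
      rw [div_mul_div_comm, hsq]
      linarith
    · simpa [slab] using h1'
    · simpa [slab] using h2'
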